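/- Let $d\ge 1$, let $\Omega\subset\mathbb{R}^d$ be compact with positive Lebesgue measure, and let $K:\Omega\times\Omega\to\mathbb{R}$ be continuous and symmetric. For $f\in L^2(\Omega)$ put $(L_Kf)(p)=\int_\Omega K(p,q)f(q)\,dq$; this is a continuous function on $\Omega$, and $L_K$ is also regarded as a bounded operator on $L^2(\Omega)$. The (Moore–Penrose) pseudo-inverse $L_K^\dagger$ is the linear map with domain $\operatorname{ran}L_K+(\operatorname{ran}L_K)^\perp\subseteq L^2(\Omega)$ that inverts the restriction of $L_K$ to $(\ker L_K)^\perp$ and vanishes on $(\operatorname{ran}L_K)^\perp$. Then $L^2(\Omega)$ has a complete orthonormal system $(\phi_n)_{n\ge0}$ with $L_K\phi_n=\lambda_n\phi_n$, $\lambda_n\in\mathbb{R}$, and for every such system $(\lambda_n,\phi_n)_{n\ge0}$ the following hold. 1. For $g\in L^2(\Omega)$, the equation $L_Kf=g$ has a solution $f\in L^2(\Omega)$ (equality in $L^2(\Omega)$) if and only if $\langle g,\phi_n\rangle_2=0$ for all $n$ with $\lambda_n=0$ and $\big(\langle g,\phi_n\rangle_2/\lambda_n\big)_{n:\lambda_n\ne0}\in\ell^2$.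 If every nonempty relatively open subset of $\Omega$ has positive measure and $g$ is continuous, the same condition is equivalent to the existence of $f\in L^2(\Omega)$ with $(L_Kf)(p)=g(p)$ for every $p\in\Omega$. 2. A function $g\in L^2(\Omega)$ lies in the domain of $L_K^\dagger$ if and only if $\big(\langle g,\phi_n\rangle_2/\lambda_n\big)_{n:\lambda_n\ne0}\in\ell^2$. For every such $g$, $$L_K^\dagger g=\sum_{n:\lambda_n\neq0}\frac{\langle g,\phi_n\rangle_2}{\lambda_n}\,\phi_n\quad\text{in }L^2(\Omega);$$ if $L_Kf=g$ is solvable in $L^2(\Omega)$ then $L_K(L_K^\dagger g)=g$; and $L_K^\dagger g$ minimises $\|L_Kf-g\|_2$ over $f\in L^2(\Omega)$. The minimisers are exactly the functions $L_K^\dagger g+h$ with $h\in\ker L_K$, and $L_K^\dagger g$ is the unique minimiser of least norm. 3. Each $\phi_n$ with $\lambda_n\ne0$ has a continuous representative. If $L_K$ has finitely many nonzero eigenvalues, then only finitely many $\lambda_n$ are nonzero, $L_K^\dagger$ is defined on all of $L^2(\Omega)$, and $L_K^\dagger=L_{K^\dagger}$ is the integral operator with the continuous kernel $K^\dagger(p,q)=\sum_{n:\lambda_n\ne0}\lambda_n^{-1}\phi_n(p)\phi_n(q)$,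 for any continuous representatives of the $\phi_n$ with $\lambda_n\neq 0$. -/

import Mathlib

open MeasureTheory

open scoped RealInnerProductSpace

noncomputable section

/-- Lebesgue measure on `Ω ⊆ ℝᵈ`. -/
def lebesgueOn {d : ℕ} (Ω : Set (EuclideanSpace ℝ (Fin d))) : Measure Ω :=
  Measure.comap Subtype.val volume

instance isFiniteMeasure_lebesgueOn {d : ℕ} (Ω : Set (EuclideanSpace ℝ (Fin d)))
    [CompactSpace Ω] : IsFiniteMeasure (lebesgueOn Ω) := by
  have hΩ : IsCompact Ω := isCompact_iff_compactSpace.mpr inferInstance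
  refine ⟨?_⟩
  rw [lebesgueOn, comap_subtype_coe_apply hΩ.isClosed.measurableSet]
  simpa using hΩ.measure_lt_top

/-- The real Hilbert space `L²(Ω)` over a set `Ω ⊆ ℝᵈ` with Lebesgue measure. -/
abbrev L2 {d : ℕ} (Ω : Set (EuclideanSpace ℝ (Fin d))) : Type :=
  Lp ℝ 2 (lebesgueOn Ω)

/-- The inclusion `C⁰(Ω) → L²(Ω)`, for compact `Ω`. -/
def toL2 {d : ℕ} (Ω : Set (EuclideanSpace ℝ (Fin d))) [CompactSpace Ω] :
    C(Ω, ℝ) →L[ℝ] L2 Ω :=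
  ContinuousMap.toLp 2 (lebesgueOn Ω) ℝ

/-- The integral `∫_Ω K(p, q) f(q) dq` is the scalar product `⟨K(p, ·), f⟩₂`. -/
theorem integral_kernel_eq_inner {d : ℕ} {Ω : Set (EuclideanSpace ℝ (Fin d))} [CompactSpace Ω]
    (K : C(Ω × Ω, ℝ)) (f : L2 Ω) (p : Ω) :
    ∫ q : Ω, K (p, q) * f q ∂lebesgueOn Ω = ⟪toL2 Ω (K.curry p), f⟫ := by
  rw [L2.inner_def]
  refine integral_congr_ae ?_
  filter_upwards [ContinuousMap.coeFn_toLp (p := 2) (𝕜 := ℝ) (lebesgueOn Ω) (K.curry p)]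
    with q hq
  have hq' : (toL2 Ω (K.curry p)) q = K (p, q) := hq
  simp [hq', mul_comm]

/-- The continuous F-transform `L_K : L²(Ω) → C⁰(Ω)`, `(L_K f)(p) = ∫_Ω K(p, q) f(q) dq`. -/
def continuousFTransform {d : ℕ} {Ω : Set (EuclideanSpace ℝ (Fin d))} [CompactSpace Ω]
    (K : C(Ω × Ω, ℝ)) : L2 Ω →ₗ[ℝ] C(Ω, ℝ) where
  toFun f :=
    { toFun := fun p => ∫ q : Ω, K (p, q) * f q ∂lebesgueOn Ω
      continuous_toFun := by
        simp_rw [integral_kernel_eq_inner]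
        fun_prop }
  map_add' f g := by
    ext p
    change ∫ q : Ω, K (p, q) * (f + g : L2 Ω) q ∂lebesgueOn Ω =
      ∫ q : Ω, K (p, q) * f q ∂lebesgueOn Ω + ∫ q : Ω, K (p, q) * g q ∂lebesgueOn Ω
    rw [integral_kernel_eq_inner, integral_kernel_eq_inner, integral_kernel_eq_inner,
      inner_add_right]
  map_smul' c f := by
    ext p
    change ∫ q : Ω, K (p, q) * (c • f : L2 Ω) q ∂lebesgueOn Ω =
      c • ∫ q : Ω, K (p, q) * f q ∂lebesgueOn Ω
    rw [integral_kernel_eq_inner, integral_kernel_eq_inner, inner_smul_right, smul_eq_mul]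

/-- The F-transform is bounded for the maximum norm. -/
theorem norm_continuousFTransform_le {d : ℕ} {Ω : Set (EuclideanSpace ℝ (Fin d))}
    [CompactSpace Ω] (K : C(Ω × Ω, ℝ)) (f : L2 Ω) :
    ‖continuousFTransform K f‖ ≤ (‖toL2 Ω‖ * ‖K.curry‖) * ‖f‖ := by
  rw [ContinuousMap.norm_le _ (by positivity)]
  intro p
  change ‖∫ q : Ω, K (p, q) * f q ∂lebesgueOn Ω‖ ≤ _
  rw [integral_kernel_eq_inner]
  refine (norm_inner_le_norm _ _).trans ?_
  gcongr
  refine ((toL2 Ω).le_opNorm _).trans ?_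
  gcongr
  exact K.curry.norm_coe_le_norm p

/-- The integral operator `L_K` as a bounded operator of `L²(Ω)`: the F-transform followed by the
inclusion of `C⁰(Ω)` in `L²(Ω)`. -/
def integralOperator {d : ℕ} {Ω : Set (EuclideanSpace ℝ (Fin d))} [CompactSpace Ω]
    (K : C(Ω × Ω, ℝ)) : L2 Ω →L[ℝ] L2 Ω :=
  (toL2 Ω).comp ((continuousFTransform K).mkContinuous _ (norm_continuousFTransform_le K))

/-- The graph of the Moore–Penrose pseudo-inverse of `T`: the pairs `(g, f)` such that `f` is
orthogonal to `ker T` and `g = T f + r` with `r` orthogonal to `range T`. -/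
def pseudoInverseGraph {H : Type*} [NormedAddCommGroup H] [InnerProductSpace ℝ H]
    (T : H →L[ℝ] H) : Submodule ℝ (H × H) where
  carrier := {x | x.2 ∈ (LinearMap.ker (T : H →ₗ[ℝ] H))ᗮ ∧
    x.1 - T x.2 ∈ (LinearMap.range (T : H →ₗ[ℝ] H))ᗮ}
  zero_mem' := by simp
  add_mem' := by
    rintro x y ⟨hx, hx'⟩ ⟨hy, hy'⟩
    refine ⟨Submodule.add_mem _ hx hy, ?_⟩
    have h := Submodule.add_mem _ hx' hy'
    rwa [sub_add_sub_comm, ← map_add] at h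
  smul_mem' := by
    rintro c x ⟨hx, hx'⟩
    refine ⟨Submodule.smul_mem _ c hx, ?_⟩
    have h := Submodule.smul_mem _ c hx'
    rwa [smul_sub, ← map_smul] at h

/-- The pairs above do form the graph of a function. -/
theorem pseudoInverseGraph_functional {H : Type*} [NormedAddCommGroup H]
    [InnerProductSpace ℝ H] (T : H →L[ℝ] H) (x : H × H) (hx : x ∈ pseudoInverseGraph T)
    (h0 : x.1 = 0) : x.2 = 0 := by
  obtain ⟨h1, h2⟩ := hx
  have h3 : T x.2 = 0 := by
    have h4 := h2 (T x.2) ⟨x.2, rfl⟩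
    rw [h0, zero_sub, inner_neg_right, neg_eq_zero] at h4
    exact inner_self_eq_zero.mp h4
  exact inner_self_eq_zero.mp (h1 x.2 h3)

/-- The Moore–Penrose pseudo-inverse `T†` of a bounded operator `T` of a Hilbert space. It is a
linear map with domain `range T + (range T)ᗮ`: the inverse of the restriction of `T` to
`(ker T)ᗮ`, extended by zero on `(range T)ᗮ`. -/
def pseudoInverse {H : Type*} [NormedAddCommGroup H] [InnerProductSpace ℝ H]
    (T : H →L[ℝ] H) : H →ₗ.[ℝ] H :=
  (pseudoInverseGraph T).toLinearPMap

/-- The tensor kernel `(φ ⊗ φ)(p, q) = φ(p) φ(q)`. -/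
def tensorKernel {X : Type*} [TopologicalSpace X] (φ : C(X, ℝ)) : C(X × X, ℝ) where
  toFun x := φ x.1 * φ x.2

/-- The pseudo-inverse kernel `K†(p, q) = ∑ λ_n⁻¹ φ_n(p) φ_n(q)`, where the sum runs over the `n`
with `λ_n ≠ 0`; it is used when there are finitely many of these. -/
def pseudoInverseKernel {X : Type*} [TopologicalSpace X] (lam : ℕ → ℝ)
    (φ : {n : ℕ // lam n ≠ 0} → C(X, ℝ)) : C(X × X, ℝ) :=
  ∑ᶠ n : {n : ℕ // lam n ≠ 0}, (lam n)⁻¹ • tensorKernel (φ n)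

end

/-!
The integral operator `L_K` is compact: since `p ↦ K(p, ·)` is continuous into `L²(Ω)`, it maps the
unit ball to a bounded equicontinuous set of functions (`isCompactOperator_integralOperator`). It is
symmetric by Fubini's theorem (`isSymmetric_integralOperator`). The spectral theorem for compact
symmetric operators therefore gives an orthonormal basis of eigenvectors
(`IsCompactOperator.exists_hilbertBasis_eigenvectors`). This basis is countable because `L²(Ω)` is
separable. It is infinite because Lebesgue measure on a set of positive measure in dimension
`d ≥ 1` charges infinitely many disjoint sets (`not_finiteDimensional_Lp_two`).

In the coordinates of an eigenbasis the operator is multiplication by `lam`. Its range, its kernel,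
their orthogonal complements and the graph of its pseudo-inverse are then described coordinate by
coordinate (`mem_pseudoInverseGraph_iff_of_eigenbasis`), and the solvability criterion, the domain
of the pseudo-inverse and its series follow from the Riesz–Fischer theorem
(`exists_hasSum_of_memℓp`). The least squares properties need no basis: they express that `g - T u`
is orthogonal to the range of `T` and `u` to its kernel, where `u = T† g`
(`norm_sq_map_sub_of_mem_graph`, `norm_lt_of_mem_graph`).

An eigenfunction with eigenvalue `c ≠ 0` is `c⁻¹ L_K f`, which is continuous. When there are
finitely many nonzero eigenvalues, the series of the pseudo-inverse is a finite sum, which is the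
integral operator of the kernel `∑ lam_n⁻¹ φ_n ⊗ φ_n` (`integralOperator_sum_tensorKernel`).
-/

/-! ### Diagonal operators and their pseudo-inverses -/

section Diagonal

variable {ι H : Type*} [NormedAddCommGroup H] [InnerProductSpace ℝ H] {T : H →L[ℝ] H}
  {lam : ι → ℝ} {φ : HilbertBasis ι ℝ H}

theorem HilbertBasis.eq_of_forall_inner_eq (φ : HilbertBasis ι ℝ H) {x y : H}
    (h : ∀ n, ⟪φ n, x⟫ = ⟪φ n, y⟫) : x = y := by
  refine φ.repr.injective (lp.ext (funext fun n => ?_))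
  simpa only [φ.repr_apply_apply] using h n

theorem inner_map_of_eigenbasis (hT : ∀ n, T (φ n) = lam n • φ n) (f : H) (n : ι) :
    ⟪φ n, T f⟫ = lam n * ⟪φ n, f⟫ := by
  have h := ((φ.hasSum_repr f).mapL T).mapL (innerSL ℝ (φ n))
  refine (h.unique (hasSum_single n fun m hm => ?_)).trans ?_
  · simp [hT, φ.orthonormal.2 hm.symm]
  · simp [hT, φ.repr_apply_apply, φ.orthonormal.1 n, mul_comm]

theorem map_eq_iff_of_eigenbasis (hT : ∀ n, T (φ n) = lam n • φ n) (f g : H) :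
    T f = g ↔ ∀ n, lam n * ⟪φ n, f⟫ = ⟪φ n, g⟫ := by
  refine ⟨?_, fun h => φ.eq_of_forall_inner_eq fun n => ?_⟩
  · rintro rfl n
    rw [inner_map_of_eigenbasis hT]
  · rw [inner_map_of_eigenbasis hT, h]

theorem mem_orthogonal_ker_iff_of_eigenbasis (hT : ∀ n, T (φ n) = lam n • φ n) (f : H) :
    f ∈ (LinearMap.ker (T : H →ₗ[ℝ] H))ᗮ ↔ ∀ n, lam n = 0 → ⟪φ n, f⟫ = 0 := by
  refine ⟨fun h n hn => h (φ n) (by simp [hT, hn]), fun h x hx => ?_⟩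
  have hx' := (map_eq_iff_of_eigenbasis hT x 0).1 hx
  rw [← φ.tsum_inner_mul_inner x f]
  refine (tsum_congr fun n => ?_).trans tsum_zero
  by_cases hn : lam n = 0
  · rw [h n hn, mul_zero]
  · have := hx' n
    rw [inner_zero_right] at this
    rw [real_inner_comm, (mul_eq_zero.1 this).resolve_left hn, zero_mul]

theorem mem_orthogonal_range_iff_of_eigenbasis (hT : ∀ n, T (φ n) = lam n • φ n) (r : H) :
    r ∈ (LinearMap.range (T : H →ₗ[ℝ] H))ᗮ ↔ ∀ n, lam n ≠ 0 → ⟪φ n, r⟫ = 0 := by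
  refine ⟨fun h n hn => h (φ n) ⟨(lam n)⁻¹ • φ n, by simp [hT, smul_smul, hn]⟩, ?_⟩
  rintro h _ ⟨x, rfl⟩
  rw [← φ.tsum_inner_mul_inner]
  refine (tsum_congr fun n => ?_).trans tsum_zero
  by_cases hn : lam n = 0
  · rw [real_inner_comm, ContinuousLinearMap.coe_coe, inner_map_of_eigenbasis hT, hn]
    simp
  · rw [h n hn, mul_zero]

/-- In the coordinates of an eigenbasis, `f = T† g` means that `f` has the coordinates
`⟪φ n, g⟫ / lam n` where `lam n ≠ 0` and `0` elsewhere. -/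
theorem mem_pseudoInverseGraph_iff_of_eigenbasis (hT : ∀ n, T (φ n) = lam n • φ n) (g f : H) :
    (g, f) ∈ pseudoInverseGraph T ↔
      ∀ n, ⟪φ n, f⟫ = if lam n = 0 then 0 else ⟪φ n, g⟫ / lam n := by
  change f ∈ _ ∧ g - T f ∈ _ ↔ _
  rw [mem_orthogonal_ker_iff_of_eigenbasis hT, mem_orthogonal_range_iff_of_eigenbasis hT,
    ← forall_and]
  refine forall_congr' fun n => ?_
  rw [inner_sub_right, inner_map_of_eigenbasis hT]
  split_ifs with hn
  · simp [hn]
  · simp only [hn, false_implies, true_and, ne_eq, not_false_eq_true, true_implies]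
    rw [sub_eq_zero, eq_div_iff hn, mul_comm, eq_comm]

theorem mem_domain_pseudoInverse_iff (g : H) :
    g ∈ (pseudoInverse T).domain ↔ ∃ f, (g, f) ∈ pseudoInverseGraph T := by
  simp [pseudoInverse, Submodule.toLinearPMap_domain]

theorem pseudoInverse_mem_graph (g : (pseudoInverse T).domain) :
    ((g : H), pseudoInverse T g) ∈ pseudoInverseGraph T :=
  Submodule.mem_graph_toLinearPMap (pseudoInverseGraph_functional T) g

/-- Square-summable coordinates on a set of indices are those of a vector (Riesz–Fischer). -/
theorem exists_hasSum_of_memℓp [CompleteSpace H] (φ : HilbertBasis ι ℝ H) {p : ι → Prop}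
    {c : {n // p n} → ℝ} (hc : Memℓp c 2) :
    ∃ u : H, HasSum (fun n : {n // p n} => c n • φ n) u := by
  have hv : Orthonormal ℝ fun n : {n // p n} => φ n :=
    φ.orthonormal.comp _ Subtype.val_injective
  exact ⟨_, by simpa using! hv.orthogonalFamily.hasSum_linearIsometry ⟨c, hc⟩⟩

open Classical in
theorem inner_of_hasSum_subtype {p : ι → Prop} {c : {n // p n} → ℝ} {u : H}
    (h : HasSum (fun n : {n // p n} => c n • φ n) u) (n : ι) :
    ⟪φ n, u⟫ = if hn : p n then c ⟨n, hn⟩ else 0 := by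
  have h' := h.mapL (innerSL ℝ (φ n))
  split_ifs with hn
  · refine (h'.unique (hasSum_single (⟨n, hn⟩ : {n // p n}) fun m hm => ?_)).trans ?_
    · have : n ≠ m := fun e => hm (Subtype.ext e.symm)
      simp [φ.orthonormal.2 this]
    · simp [φ.orthonormal.1 n]
  · refine h'.unique ?_
    convert! hasSum_zero using 2 with m
    have : n ≠ m := fun e => hn (e ▸ m.2)
    simp [φ.orthonormal.2 this]

theorem memℓp_inner_subtype (φ : HilbertBasis ι ℝ H) (p : ι → Prop) (u : H) :
    Memℓp (fun n : {n // p n} => ⟪φ n, u⟫) 2 := by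
  refine memℓp_gen ?_
  have := (φ.orthonormal.inner_products_summable u).subtype {n | p n}
  simpa using! this

/-- The spectral series of `T† g`, when its coefficients are square-summable. -/
theorem exists_hasSum_mem_graph [CompleteSpace H] (hT : ∀ n, T (φ n) = lam n • φ n) {g : H}
    (hg : Memℓp (fun n : {n // lam n ≠ 0} => ⟪g, φ n⟫ / lam n) 2) :
    ∃ u : H, HasSum (fun n : {n // lam n ≠ 0} => (⟪g, φ n⟫ / lam n) • φ n) u ∧
      (g, u) ∈ pseudoInverseGraph T := by
  obtain ⟨u, hu⟩ := exists_hasSum_of_memℓp φ hg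
  refine ⟨u, hu, (mem_pseudoInverseGraph_iff_of_eigenbasis hT g u).2 fun n => ?_⟩
  rw [inner_of_hasSum_subtype hu n]
  by_cases hn : lam n = 0 <;> simp [hn, real_inner_comm]

theorem memℓp_of_mem_graph (hT : ∀ n, T (φ n) = lam n • φ n) {g f : H}
    (h : (g, f) ∈ pseudoInverseGraph T) :
    Memℓp (fun n : {n // lam n ≠ 0} => ⟪g, φ n⟫ / lam n) 2 := by
  convert! memℓp_inner_subtype φ (fun n => lam n ≠ 0) f using 2 with n
  rw [(mem_pseudoInverseGraph_iff_of_eigenbasis hT g f).1 h n, if_neg n.2, real_inner_comm]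

/-- Picard's criterion: the range of a diagonal operator. -/
theorem exists_map_eq_iff_of_eigenbasis [CompleteSpace H] (hT : ∀ n, T (φ n) = lam n • φ n)
    (g : H) : (∃ f, T f = g) ↔ (∀ n, lam n = 0 → ⟪g, φ n⟫ = 0) ∧
      Memℓp (fun n : {n // lam n ≠ 0} => ⟪g, φ n⟫ / lam n) 2 := by
  constructor
  · rintro ⟨f, hf⟩
    have hf' := (map_eq_iff_of_eigenbasis hT f g).1 hf
    refine ⟨fun n hn => by rw [real_inner_comm, ← hf' n, hn, zero_mul], ?_⟩
    convert! memℓp_inner_subtype φ (fun n => lam n ≠ 0) f using 2 with n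
    rw [real_inner_comm, ← hf' n, mul_div_cancel_left₀ _ n.2]
  · rintro ⟨h0, hg⟩
    obtain ⟨u, -, hu⟩ := exists_hasSum_mem_graph hT hg
    rw [mem_pseudoInverseGraph_iff_of_eigenbasis hT] at hu
    refine ⟨u, (map_eq_iff_of_eigenbasis hT u g).2 fun n => ?_⟩
    rw [hu n]
    split_ifs with hn
    · rw [mul_zero, real_inner_comm, h0 n hn]
    · rw [mul_div_cancel₀ _ hn]

theorem mem_domain_pseudoInverse_iff_memℓp [CompleteSpace H]
    (hT : ∀ n, T (φ n) = lam n • φ n) (g : H) :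
    g ∈ (pseudoInverse T).domain ↔
      Memℓp (fun n : {n // lam n ≠ 0} => ⟪g, φ n⟫ / lam n) 2 := by
  rw [mem_domain_pseudoInverse_iff]
  exact ⟨fun ⟨_, hf⟩ => memℓp_of_mem_graph hT hf,
    fun h => (exists_hasSum_mem_graph hT h).imp fun _ hu => hu.2⟩

theorem hasSum_pseudoInverse [CompleteSpace H] (hT : ∀ n, T (φ n) = lam n • φ n)
    (g : (pseudoInverse T).domain) :
    HasSum (fun n : {n // lam n ≠ 0} => (⟪(g : H), φ n⟫ / lam n) • φ n) (pseudoInverse T g) := by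
  have hg := pseudoInverse_mem_graph g
  obtain ⟨u, hu, hu'⟩ := exists_hasSum_mem_graph hT (memℓp_of_mem_graph hT hg)
  rw [mem_pseudoInverseGraph_iff_of_eigenbasis hT] at hg hu'
  rwa [φ.eq_of_forall_inner_eq fun n => (hg n).trans (hu' n).symm]

end Diagonal

/-! ### Least squares solutions -/

section LeastSquares

variable {H : Type*} [NormedAddCommGroup H] [InnerProductSpace ℝ H] {T : H →L[ℝ] H} {g u : H}

/-- The residual `g - T u` is orthogonal to the range of `T`, so Pythagoras' theorem applies; all
minimising properties of `u = T† g` are read off from this identity. -/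
theorem norm_sq_map_sub_of_mem_graph (h : (g, u) ∈ pseudoInverseGraph T) (f : H) :
    ‖T f - g‖ ^ 2 = ‖T (f - u)‖ ^ 2 + ‖T u - g‖ ^ 2 := by
  have h0 : ⟪T (f - u), g - T u⟫ = 0 := h.2 _ ⟨f - u, rfl⟩
  have h1 : T f - g = T (f - u) - (g - T u) := by
    rw [map_sub]
    abel
  rw [h1, norm_sub_rev (T u), norm_sub_sq_real, h0]
  ring

theorem norm_map_sub_le_of_mem_graph (h : (g, u) ∈ pseudoInverseGraph T) (f : H) :
    ‖T u - g‖ ≤ ‖T f - g‖ := by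
  refine le_of_sq_le_sq ?_ (norm_nonneg _)
  rw [norm_sq_map_sub_of_mem_graph h f]
  exact le_add_of_nonneg_left (sq_nonneg _)

theorem forall_norm_map_sub_le_iff_of_mem_graph (h : (g, u) ∈ pseudoInverseGraph T) (f : H) :
    (∀ x, ‖T f - g‖ ≤ ‖T x - g‖) ↔ T (f - u) = 0 := by
  have hf := norm_sq_map_sub_of_mem_graph h f
  constructor
  · intro hmin
    have h1 : ‖T f - g‖ ^ 2 ≤ ‖T u - g‖ ^ 2 := by gcongr; exact hmin u
    have h2 : ‖T (f - u)‖ ^ 2 = 0 := le_antisymm (by linarith) (sq_nonneg _)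
    simpa using h2
  · intro h0 x
    rw [map_sub, sub_eq_zero] at h0
    rw [h0]
    exact norm_map_sub_le_of_mem_graph h x

/-- Uniqueness of the least squares solution of least norm: `u` is orthogonal to `f - u ∈ ker T`. -/
theorem norm_lt_of_mem_graph (h : (g, u) ∈ pseudoInverseGraph T) {f : H} (hf : T (f - u) = 0)
    (hne : f ≠ u) : ‖u‖ < ‖f‖ := by
  have h0 : ⟪f - u, u⟫ = 0 := h.1 _ hf
  have h1 : ‖f‖ ^ 2 = ‖f - u‖ ^ 2 + ‖u‖ ^ 2 := by
    have h2 := norm_add_sq_real (f - u) u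
    rw [sub_add_cancel, h0] at h2
    linarith
  have h3 : 0 < ‖f - u‖ := norm_pos_iff.2 (sub_ne_zero.2 hne)
  refine lt_of_pow_lt_pow_left₀ 2 (norm_nonneg _) ?_
  rw [h1]
  exact lt_add_of_pos_left _ (by positivity)

theorem map_eq_of_mem_graph (h : (g, u) ∈ pseudoInverseGraph T) (hg : ∃ f, T f = g) :
    T u = g := by
  obtain ⟨f, rfl⟩ := hg
  have h1 := norm_map_sub_le_of_mem_graph h f
  rwa [sub_self, norm_zero, norm_le_zero_iff, sub_eq_zero] at h1

end LeastSquares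

/-! ### Eigenbases of compact self-adjoint operators -/

/-- The balls of radius `1 / 2` around the vectors are disjoint, the distances being `√2`. -/
theorem Orthonormal.countable_index {ι H : Type*} [NormedAddCommGroup H] [InnerProductSpace ℝ H]
    [TopologicalSpace.SeparableSpace H] {v : ι → H} (hv : Orthonormal ℝ v) : Countable ι := by
  refine Pairwise.countable_of_isOpen_disjoint (s := fun i => Metric.ball (v i) (1 / 2)) ?_
    (fun _ => Metric.isOpen_ball) fun i => ⟨v i, Metric.mem_ball_self (by norm_num)⟩
  intro i j hij
  refine Metric.ball_disjoint_ball ?_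
  rw [dist_eq_norm]
  have h : ‖v i - v j‖ ^ 2 = 2 := by
    rw [norm_sub_sq_real, hv.2 hij, hv.1 i, hv.1 j]
    norm_num
  nlinarith [norm_nonneg (v i - v j)]

/-- Hilbert bases of the eigenspaces, the kernel included, are put together. The dimension is
assumed infinite so that the resulting basis can be indexed by `ℕ`. -/
theorem IsCompactOperator.exists_hilbertBasis_eigenvectors {H : Type*} [NormedAddCommGroup H]
    [InnerProductSpace ℝ H] [CompleteSpace H] [TopologicalSpace.SeparableSpace H]
    (hH : ¬ FiniteDimensional ℝ H) {T : H →L[ℝ] H} (hT : IsCompactOperator T)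
    (hs : (T : H →ₗ[ℝ] H).IsSymmetric) :
    ∃ (lam : ℕ → ℝ) (φ : HilbertBasis ℕ ℝ H), ∀ n, T (φ n) = lam n • φ n := by
  let E : ℝ → Submodule ℝ H := fun μ => Module.End.eigenspace (T : Module.End ℝ H) μ
  have hE : ∀ μ, IsClosed (E μ : Set H) := fun μ => by
    have : (E μ : Set H) = {x | T x = μ • x} := by
      ext x
      exact Module.End.mem_eigenspace_iff
    rw [this]
    exact isClosed_eq T.continuous (continuous_const_smul μ)
  have : ∀ μ, CompleteSpace (E μ) := fun μ => (hE μ).completeSpace_coe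
  choose w b hb using fun μ => exists_hilbertBasis ℝ (E μ)
  let v : (Σ μ, w μ) → H := fun i => (b i.1 i.2 : E i.1)
  have hv : Orthonormal ℝ v :=
    hs.orthogonalFamily_eigenspaces.orthonormal_sigma_orthonormal fun μ => (b μ).orthonormal
  have hvb : (Submodule.span ℝ (Set.range v))ᗮ = ⊥ := by
    rw [eq_bot_iff, ← T.orthogonalComplement_iSup_eigenspaces_eq_bot hT hs,
      ← Submodule.iInf_orthogonal]
    refine le_iInf fun μ x hx => ?_
    have h0 : (E μ).orthogonalProjectionOnto x = 0 := by
      refine (b μ).repr.injective (lp.ext (funext fun i => ?_))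
      rw [(b μ).repr_apply_apply, map_zero, Submodule.inner_orthogonalProjectionOnto_eq_of_mem_left]
      exact hx _ (Submodule.subset_span ⟨⟨μ, i⟩, rfl⟩)
    exact Submodule.orthogonalProjectionOnto_eq_zero_iff.1 h0
  have : Countable (Σ μ, w μ) := hv.countable_index
  have : Infinite (Σ μ, w μ) := by
    refine not_finite_iff_infinite.1 fun hfin => hH ?_
    have := Fintype.ofFinite (Σ μ, w μ)
    let B := (HilbertBasis.mkOfOrthogonalEqBot hv hvb).toOrthonormalBasis
    exact B.toBasis.finiteDimensional_of_finite
  obtain ⟨e⟩ : Nonempty (ℕ ≃ Σ μ, w μ) := nonempty_equiv_of_countable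
  have hve : (Submodule.span ℝ (Set.range (v ∘ e)))ᗮ = ⊥ := by
    rwa [e.surjective.range_comp]
  refine ⟨fun n => (e n).1,
    HilbertBasis.mkOfOrthogonalEqBot (hv.comp e e.injective) hve, fun n => ?_⟩
  rw [HilbertBasis.coe_mkOfOrthogonalEqBot]
  exact Module.End.mem_eigenspace_iff.1 (b (e n).1 (e n).2).2

/-- Finitely many distinct nonzero eigenvalues leave only finitely many indices, as the eigenspaces
of nonzero eigenvalues of a compact operator have finite dimension. -/
theorem IsCompactOperator.finite_setOf_eigenbasis_ne_zero {ι H : Type*} [NormedAddCommGroup H]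
    [InnerProductSpace ℝ H] [CompleteSpace H] {T : H →L[ℝ] H} (hT : IsCompactOperator T)
    {lam : ι → ℝ} {v : ι → H} (hv : Orthonormal ℝ v) (h : ∀ n, T (v n) = lam n • v n)
    (hfin : {μ : ℝ | μ ≠ 0 ∧ Module.End.HasEigenvalue (T : H →ₗ[ℝ] H) μ}.Finite) :
    {n | lam n ≠ 0}.Finite := by
  have hmem : ∀ n, v n ∈ Module.End.eigenspace (T : Module.End ℝ H) (lam n) := fun n =>
    Module.End.mem_eigenspace_iff.2 (h n)
  refine (hfin.biUnion (t := fun μ => {n | lam n = μ}) fun μ hμ => ?_).subset fun n hn => ?_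
  · have := T.finite_dimensional_eigenspace hT μ hμ.1
    let v' : {n | lam n = μ} → Module.End.eigenspace (T : Module.End ℝ H) μ := fun n =>
      ⟨v n, Module.End.mem_eigenspace_iff.2 ((h n).trans (congrArg (· • v n) n.2))⟩
    have hv' : LinearIndependent ℝ v' := by
      refine LinearIndependent.of_comp (Submodule.subtype _) ?_
      exact (hv.comp _ Subtype.val_injective).linearIndependent
    exact Set.finite_coe_iff.1 hv'.finite
  · refine Set.mem_biUnion (x := lam n) ⟨hn, ?_⟩ rfl
    exact Module.End.hasEigenvalue_of_hasEigenvector ⟨hmem n, hv.ne_zero n⟩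

/-! ### Infinite dimension of `L²` -/

/-- The support of `μ` is conull, hence infinite as points are null, and so it contains infinitely
many disjoint relatively open sets. A relatively open subset of the support is null only if it is
empty. -/
theorem exists_pairwise_disjoint_measure_pos {X : Type*} [TopologicalSpace X] [T2Space X]
    [HereditarilyLindelofSpace X] [MeasurableSpace X] [OpensMeasurableSpace X]
    (μ : Measure X) [NullSingletonClass μ] (hμ : μ ≠ 0) :
    ∃ A : ℕ → Set X, Pairwise (Function.onFun Disjoint A) ∧ (∀ n, MeasurableSet (A n)) ∧
      ∀ n, μ (A n) ≠ 0 := by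
  have hsupp : μ μ.supportᶜ = 0 := Measure.measure_compl_support
  have : Infinite μ.support := by
    refine Set.infinite_coe_iff.2 fun hfin => hμ ?_
    rw [← Measure.measure_univ_eq_zero, ← Set.union_compl_self μ.support]
    exact measure_union_null (hfin.measure_zero μ) hsupp
  obtain ⟨U, hU, hUo, hUd⟩ := exists_seq_infinite_isOpen_pairwise_disjoint μ.support
  choose V hVo hV using fun n => isOpen_induced_iff.1 (hUo n)
  refine ⟨fun n => V n ∩ μ.support, fun m n hmn => ?_,
    fun n => (hVo n).measurableSet.inter Measure.isClosed_support.measurableSet, fun n => ?_⟩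
  · refine Set.disjoint_left.2 fun x hx hx' => ?_
    have h1 : (⟨x, hx.2⟩ : μ.support) ∈ U m := by rw [← hV m]; exact hx.1
    have h2 : (⟨x, hx.2⟩ : μ.support) ∈ U n := by rw [← hV n]; exact hx'.1
    exact Set.disjoint_left.1 (hUd hmn) h1 h2
  · obtain ⟨x, hx⟩ := (hU n).nonempty
    rw [measure_inter_conull hsupp]
    have hx' : (x : X) ∈ V n := by rw [← hV n] at hx; exact hx
    exact ((Measure.mem_support_iff_forall (x : X)).1 x.2 _ ((hVo n).mem_nhds hx')).ne'

theorem not_finiteDimensional_Lp_two {X : Type*} [TopologicalSpace X] [T2Space X]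
    [HereditarilyLindelofSpace X] [MeasurableSpace X] [OpensMeasurableSpace X]
    (μ : Measure X) [IsFiniteMeasure μ] [NullSingletonClass μ] (hμ : μ ≠ 0) :
    ¬ FiniteDimensional ℝ (Lp ℝ 2 μ) := by
  intro hfin
  obtain ⟨A, hd, hm, hpos⟩ := exists_pairwise_disjoint_measure_pos μ hμ
  let v : ℕ → Lp ℝ 2 μ := fun n => indicatorConstLp 2 (hm n) (measure_ne_top μ _) (1 : ℝ)
  have hv : LinearIndependent ℝ v := by
    refine linearIndependent_of_ne_zero_of_inner_eq_zero (𝕜 := ℝ) (fun n h0 => ?_) fun m n hmn => ?_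
    · have h1 : ‖v n‖ ≠ 0 := by
        rw [norm_indicatorConstLp (by norm_num) (by norm_num)]
        have : 0 < μ.real (A n) := ENNReal.toReal_pos (hpos n) (measure_ne_top μ _)
        simpa using this.ne'
      exact h1 (by rw [h0, norm_zero])
    · change ⟪v m, v n⟫ = 0
      rw [L2.real_inner_indicatorConstLp_one_indicatorConstLp_one]
      simp [Set.disjoint_iff_inter_eq_empty.1 (hd hmn)]
  have := hv.finite
  exact not_finite ℕ

instance nullSingletonClass_lebesgueOn {d : ℕ} [NeZero d] (Ω : Set (EuclideanSpace ℝ (Fin d)))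
    [CompactSpace Ω] : NullSingletonClass (lebesgueOn Ω) := by
  have hΩ : IsCompact Ω := isCompact_iff_compactSpace.mpr inferInstance
  refine ⟨fun x => ?_⟩
  rw [lebesgueOn, comap_subtype_coe_apply hΩ.isClosed.measurableSet]
  simp

theorem lebesgueOn_ne_zero {d : ℕ} {Ω : Set (EuclideanSpace ℝ (Fin d))} [CompactSpace Ω]
    (hΩ : 0 < volume Ω) : lebesgueOn Ω ≠ 0 := by
  have h : IsCompact Ω := isCompact_iff_compactSpace.mpr inferInstance
  rw [← Measure.measure_univ_ne_zero, lebesgueOn, comap_subtype_coe_apply h.isClosed.measurableSet]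
  simpa using hΩ.ne'

/-! ### The integral operator -/

section IntegralOperator

variable {d : ℕ} {Ω : Set (EuclideanSpace ℝ (Fin d))} [CompactSpace Ω]

theorem continuousFTransform_apply (K : C(Ω × Ω, ℝ)) (f : L2 Ω) (p : Ω) :
    continuousFTransform K f p = ⟪toL2 Ω (K.curry p), f⟫ :=
  integral_kernel_eq_inner K f p

theorem integralOperator_apply (K : C(Ω × Ω, ℝ)) (f : L2 Ω) :
    integralOperator K f = toL2 Ω (continuousFTransform K f) := rfl

theorem coeFn_integralOperator (K : C(Ω × Ω, ℝ)) (f : L2 Ω) :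
    integralOperator K f =ᵐ[lebesgueOn Ω] fun p => ∫ q, K (p, q) * f q ∂lebesgueOn Ω :=
  ContinuousMap.coeFn_toLp (p := 2) (𝕜 := ℝ) (lebesgueOn Ω) (continuousFTransform K f)

/-- The kernel functions `K(p, ·)` depend continuously on `p` in `L²(Ω)`, so the image of the unit
ball is equicontinuous, and the Arzelà–Ascoli theorem applies. -/
theorem isCompactOperator_integralOperator (K : C(Ω × Ω, ℝ)) :
    IsCompactOperator (integralOperator K) := by
  let S : L2 Ω →L[ℝ] C(Ω, ℝ) :=
    (continuousFTransform K).mkContinuous _ (norm_continuousFTransform_le K)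
  let e := ContinuousMap.linearIsometryBoundedOfCompact Ω ℝ ℝ
  have hS : IsCompactOperator (fun f => e (S f)) := by
    rw [isCompactOperator_iff_exists_mem_nhds_isCompact_closure_image]
    refine ⟨Metric.closedBall 0 1, Metric.closedBall_mem_nhds 0 one_pos, ?_⟩
    refine BoundedContinuousFunction.arzela_ascoli (Metric.closedBall 0 ‖S‖)
      (isCompact_closedBall _ _) _ ?_ ?_
    · rintro _ p ⟨f, hf, rfl⟩
      rw [mem_closedBall_zero_iff] at hf ⊢
      refine ((S f).norm_coe_le_norm p).trans ((S.le_opNorm f).trans ?_)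
      exact mul_le_of_le_one_right (norm_nonneg _) hf
    · intro p
      rw [Metric.equicontinuousAt_iff_right]
      intro ε hε
      have hc : Continuous fun q : Ω => toL2 Ω (K.curry q) := by fun_prop
      filter_upwards [Metric.continuousAt_iff'.1 hc.continuousAt ε hε] with q hq
      rintro ⟨_, f, hf, rfl⟩
      rw [mem_closedBall_zero_iff] at hf
      change dist (continuousFTransform K f p) (continuousFTransform K f q) < ε
      rw [continuousFTransform_apply, continuousFTransform_apply, dist_comm, dist_eq_norm,
        ← inner_sub_left]
      refine (norm_inner_le_norm _ _).trans_lt (lt_of_le_of_lt ?_ hq)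
      rw [dist_eq_norm]
      exact mul_le_of_le_one_right (norm_nonneg _) hf
  have h := hS.clm_comp ((toL2 Ω).comp (e.symm.toContinuousLinearEquiv : _ →L[ℝ] _))
  exact h

theorem integrable_kernel_mul_mul (K : C(Ω × Ω, ℝ)) (f g : L2 Ω) :
    Integrable (fun x : Ω × Ω => g x.1 * (K x * f x.2)) ((lebesgueOn Ω).prod (lebesgueOn Ω)) := by
  have hf : Integrable f (lebesgueOn Ω) := (Lp.memLp f).integrable one_le_two
  have hg : Integrable g (lebesgueOn Ω) := (Lp.memLp g).integrable one_le_two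
  refine ((hg.mul_prod hf).bdd_mul (c := ‖K‖) K.continuous.aestronglyMeasurable
    (Filter.Eventually.of_forall fun x => K.norm_coe_le_norm x)).congr ?_
  exact Filter.Eventually.of_forall fun x => by ring

/-- Symmetry of the kernel gives a symmetric operator, by Fubini's theorem. -/
theorem isSymmetric_integralOperator {K : C(Ω × Ω, ℝ)} (hK : ∀ p q : Ω, K (p, q) = K (q, p)) :
    (integralOperator K : L2 Ω →ₗ[ℝ] L2 Ω).IsSymmetric := by
  have key : ∀ f g : L2 Ω, ⟪integralOperator K f, g⟫ =
      ∫ p, ∫ q, g p * (K (p, q) * f q) ∂lebesgueOn Ω ∂lebesgueOn Ω := fun f g => by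
    rw [L2.inner_def]
    refine integral_congr_ae ?_
    filter_upwards [coeFn_integralOperator K f] with p hp
    rw [hp, integral_const_mul]
    simp
  intro f g
  rw [ContinuousLinearMap.coe_coe, real_inner_comm _ f]
  refine (key f g).trans (Eq.trans ?_ (key g f).symm)
  rw [integral_integral_swap (integrable_kernel_mul_mul K f g)]
  simp only [hK, mul_left_comm, mul_comm]

theorem exists_continuous_eigenfunction {K : C(Ω × Ω, ℝ)} {f : L2 Ω} {c : ℝ} (hc : c ≠ 0)
    (h : integralOperator K f = c • f) : ∃ ψ : C(Ω, ℝ), toL2 Ω ψ = f :=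
  ⟨c⁻¹ • continuousFTransform K f, by
    rw [map_smul, ← integralOperator_apply, h, smul_smul, inv_mul_cancel₀ hc, one_smul]⟩

theorem integralOperator_sum_tensorKernel {ι : Type*} [Fintype ι] (c : ι → ℝ) (ψ : ι → C(Ω, ℝ))
    (g : L2 Ω) : integralOperator (∑ n, c n • tensorKernel (ψ n)) g =
      ∑ n, (c n * ⟪toL2 Ω (ψ n), g⟫) • toL2 Ω (ψ n) := by
  simp_rw [integralOperator_apply, ← map_smul, ← map_sum]
  congr 1
  ext p
  have h : (∑ n, c n • tensorKernel (ψ n)).curry p = ∑ n, (c n * ψ n p) • ψ n := by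
    ext q
    simp [tensorKernel, mul_assoc]
  rw [continuousFTransform_apply, h, map_sum, sum_inner]
  simp only [map_smul, real_inner_smul_left, ContinuousMap.coe_sum, Finset.sum_apply,
    ContinuousMap.coe_smul, Pi.smul_apply, smul_eq_mul]
  exact Finset.sum_congr rfl fun n _ => by ring

/-- Where no nonempty open set is null, a continuous function is determined by its class in
`L²(Ω)`. -/
theorem toL2_injective (h : ∀ U : Set Ω, IsOpen U → U.Nonempty → 0 < lebesgueOn Ω U) :
    Function.Injective (toL2 Ω) := by
  have : (lebesgueOn Ω).IsOpenPosMeasure := ⟨fun U hU hne => (h U hU hne).ne'⟩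
  exact ContinuousMap.toLp_injective (lebesgueOn Ω)

end IntegralOperator

/-! ### Symmetric kernels on compact sets of positive measure -/

theorem mainTheorem6 {d : ℕ} (hd : 0 < d) (Ω : Set (EuclideanSpace ℝ (Fin d)))
    [CompactSpace Ω] (hΩ : 0 < volume Ω) (K : C(Ω × Ω, ℝ))
    (hK : ∀ p q : Ω, K (p, q) = K (q, p)) :
    -- a complete orthonormal eigensystem exists
    (∃ (lam : ℕ → ℝ) (φ : HilbertBasis ℕ ℝ (L2 Ω)),
      ∀ n, integralOperator K (φ n) = lam n • φ n) ∧
    -- and for every such eigensystem: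
    ∀ (lam : ℕ → ℝ) (φ : HilbertBasis ℕ ℝ (L2 Ω)),
      (∀ n, integralOperator K (φ n) = lam n • φ n) →
      -- solvability of `L_K f = g` in `L²(Ω)`
      (∀ g : L2 Ω, (∃ f : L2 Ω, integralOperator K f = g) ↔
        (∀ n, lam n = 0 → ⟪g, φ n⟫ = 0) ∧
          Memℓp (fun n : {n : ℕ // lam n ≠ 0} => ⟪g, φ n⟫ / lam n) 2) ∧
      -- solvability at every point of `Ω` for continuous `g`, if the relatively open sets of `Ω`
      -- are not null
      ((∀ U : Set Ω, IsOpen U → U.Nonempty → 0 < lebesgueOn Ω U) →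
        ∀ g : C(Ω, ℝ), (∃ f : L2 Ω, ∀ p : Ω, continuousFTransform K f p = g p) ↔
          (∀ n, lam n = 0 → ⟪toL2 Ω g, φ n⟫ = 0) ∧
            Memℓp (fun n : {n : ℕ // lam n ≠ 0} => ⟪toL2 Ω g, φ n⟫ / lam n) 2) ∧
      -- the domain of the pseudo-inverse
      (∀ g : L2 Ω, g ∈ (pseudoInverse (integralOperator K)).domain ↔
        Memℓp (fun n : {n : ℕ // lam n ≠ 0} => ⟪g, φ n⟫ / lam n) 2) ∧
      (∀ g : (pseudoInverse (integralOperator K)).domain,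
        -- its spectral representation
        HasSum (fun n : {n : ℕ // lam n ≠ 0} => (⟪(g : L2 Ω), φ n⟫ / lam n) • φ n)
          (pseudoInverse (integralOperator K) g) ∧
        -- it solves the equation whenever there is a solution
        ((∃ f : L2 Ω, integralOperator K f = g) →
          integralOperator K (pseudoInverse (integralOperator K) g) = g) ∧
        -- it is a minimiser of `‖L_K f - g‖₂`
        (∀ f : L2 Ω, ‖integralOperator K (pseudoInverse (integralOperator K) g) - g‖ ≤
          ‖integralOperator K f - g‖) ∧
        -- the minimisers are its translates by the kernel of `L_K`, and it is the one of least norm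
        (∀ f : L2 Ω, (∀ h : L2 Ω, ‖integralOperator K f - g‖ ≤ ‖integralOperator K h - g‖) ↔
          integralOperator K (f - pseudoInverse (integralOperator K) g) = 0) ∧
        (∀ f : L2 Ω, (∀ h : L2 Ω, ‖integralOperator K f - g‖ ≤ ‖integralOperator K h - g‖) →
          f ≠ pseudoInverse (integralOperator K) g →
            ‖pseudoInverse (integralOperator K) g‖ < ‖f‖)) ∧
      -- the eigenfunctions of the nonzero eigenvalues are continuous
      (∀ n, lam n ≠ 0 → ∃ ψ : C(Ω, ℝ), toL2 Ω ψ = φ n) ∧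
      -- finitely many nonzero eigenvalues
      ({μ : ℝ | μ ≠ 0 ∧
          Module.End.HasEigenvalue (integralOperator K : L2 Ω →ₗ[ℝ] L2 Ω) μ}.Finite →
        {n : ℕ | lam n ≠ 0}.Finite ∧
        (pseudoInverse (integralOperator K)).domain = ⊤ ∧
        ∀ ψ : {n : ℕ // lam n ≠ 0} → C(Ω, ℝ), (∀ n, toL2 Ω (ψ n) = φ n) →
          ∀ g : (pseudoInverse (integralOperator K)).domain,
            pseudoInverse (integralOperator K) g =
              integralOperator (pseudoInverseKernel lam ψ) g) := by

  have : NeZero d := ⟨hd.ne'⟩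
  have : Fact ((2 : ENNReal) ≠ ⊤) := ⟨by simp⟩
  have hcomp := isCompactOperator_integralOperator K
  refine ⟨hcomp.exists_hilbertBasis_eigenvectors
    (not_finiteDimensional_Lp_two _ (lebesgueOn_ne_zero hΩ)) (isSymmetric_integralOperator hK),
    fun lam φ hφ => ⟨exists_map_eq_iff_of_eigenbasis hφ, fun hU g => ?_,
      mem_domain_pseudoInverse_iff_memℓp hφ, fun g => ?_,
      fun n hn => exists_continuous_eigenfunction hn (hφ n), fun hfin => ?_⟩⟩
  · rw [← exists_map_eq_iff_of_eigenbasis hφ]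
    refine exists_congr fun f => ?_
    rw [integralOperator_apply, (toL2_injective hU).eq_iff, ContinuousMap.ext_iff]
  · have hg := pseudoInverse_mem_graph g
    refine ⟨hasSum_pseudoInverse hφ g, map_eq_of_mem_graph hg, norm_map_sub_le_of_mem_graph hg,
      forall_norm_map_sub_le_iff_of_mem_graph hg, fun f hf hne => ?_⟩
    exact norm_lt_of_mem_graph hg ((forall_norm_map_sub_le_iff_of_mem_graph hg f).1 hf) hne
  · have hn := hcomp.finite_setOf_eigenbasis_ne_zero φ.orthonormal hφ hfin
    have : Finite {n : ℕ // lam n ≠ 0} := Set.finite_coe_iff.2 hn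
    have := Fintype.ofFinite {n : ℕ // lam n ≠ 0}
    refine ⟨hn, ?_, fun ψ hψ g => ?_⟩
    · exact eq_top_iff.2 fun g _ => (mem_domain_pseudoInverse_iff_memℓp hφ g).2 (Memℓp.all _)
    · refine (hasSum_pseudoInverse hφ g).unique ?_
      rw [pseudoInverseKernel, finsum_eq_sum_of_fintype, integralOperator_sum_tensorKernel]
      convert! hasSum_fintype _ using 3 with n
      · rw [hψ, real_inner_comm, div_eq_inv_mul]
      · exact hψ n
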